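/- Let $G$ be an infinite, finitely generated, residually finite group and let $A$ be a finite alphabet with $|A|\ge 2$. Let $X=A^G$ be the full shift, with the product topology ($A$ discrete) and the action $(g\cdot x)_a = x_{ag}$ of $G$. Then there is a finite-index (hence finitely generated) subgroup $H\le G$ such that $(X,H)$ satisfies the strong finitary Ryan theorem. That is, writing $\mathrm{Homeo}(X)$ for the group of all self-homeomorphisms of $X$ and $\mathrm{Aut}(X,H)$ for the subgroup of those commuting with the action of every $h\in H$, there is a finitely generated subgroup $K\le \mathrm{Aut}(X,H)$ whose centralizer in $\mathrm{Homeo}(X)$ is exactly the group of shifts $H$, that is, $C_{\mathrm{Homeo}(X)}(K)=\{x\mapsto h\cdot x : h\in H\}$. -/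

import Mathlib

namespace FinitaryRyan

/-- The full `A`-shift over `G`: the action of `G` on `G → A` (product topology) by
homeomorphisms, `(shift g x) a = x (a * g)`. As everywhere below, a `G`-system on `X` is a
homomorphism from `G` to the group `X ≃ₜ X` of self-homeomorphisms of `X`. -/
def fullShift (A G : Type*) [TopologicalSpace A] [Group G] : G →* ((G → A) ≃ₜ (G → A)) where
  toFun g :=
    { toFun := fun x a => x (a * g)
      invFun := fun x a => x (a * g⁻¹)
      left_inv := fun x => by funext a; simp
      right_inv := fun x => by funext a; simp
      continuous_toFun := by fun_prop
      continuous_invFun := by fun_prop }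
  map_one' := by ext x a; simp
  map_mul' g h := by ext x a; simp [mul_assoc]

theorem fullShift_apply {A G : Type*} [TopologicalSpace A] [Group G] (g : G) (x : G → A) (a : G) :
    fullShift A G g x a = x (a * g) := rfl

/-- The system obtained by restricting the action to a subgroup `H`. -/
def restrict {G X : Type*} [Group G] [TopologicalSpace X] (ρ : G →* (X ≃ₜ X)) (H : Subgroup G) :
    H →* (X ≃ₜ X) :=
  ρ.comp H.subtype

/-- The automorphism group of a system: the self-homeomorphisms commuting with the action. -/
def autGroup {G X : Type*} [Group G] [TopologicalSpace X] (ρ : G →* (X ≃ₜ X)) :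
    Subgroup (X ≃ₜ X) where
  carrier := {φ | ∀ g : G, φ * ρ g = ρ g * φ}
  one_mem' := fun g => by simp
  mul_mem' := fun {φ ψ} hφ hψ g => by rw [mul_assoc, hψ g, ← mul_assoc, hφ g, mul_assoc]
  inv_mem' := fun {φ} hφ g => by
    rw [inv_mul_eq_iff_eq_mul, ← mul_assoc, hφ g, mul_assoc, mul_inv_cancel, mul_one]

/-- The strong finitary Ryan theorem for a system: some finitely generated group of automorphisms
has, as its centralizer in the group of all self-homeomorphisms, exactly the acting group
(that is, its image in the homeomorphism group). -/
def StrongFinitaryRyan {G X : Type*} [Group G] [TopologicalSpace X] (ρ : G →* (X ≃ₜ X)) : Prop :=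
  ∃ K : Subgroup (X ≃ₜ X), K ≤ autGroup ρ ∧ K.FG ∧
    Subgroup.centralizer (K : Set (X ≃ₜ X)) = ρ.range

end FinitaryRyan

open Function Filter Topology
open scoped commutatorElement

namespace FinitaryRyan

/-! ### Even permutations with prescribed values -/

section Permutations

variable {C : Type*} [Fintype C] [DecidableEq C]

/-! Residual finiteness gives a finite-index `H` with at least six cosets. Splitting the cosets into
two blocks of at least three turns `A^G`, as an `H`-system, into two tracks `C^H × D^H` with `|C|,
|D| ≥ 8`. Take `K` generated by the finite group of cellwise permutations of `C × D` and by the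
independent slides of the two tracks; the slides multiply on the left, so they commute with the
shift.

Commutators build from these the even permutations of one track controlled by any cylinder of the
other (`gate_mem`, using that the alternating group is perfect). A map commuting with such gates
preserves their common fixed points. Hence it translates every pair whose control track has a marker
occurring once (`exists_eq_translatePair`). The translation does not depend on the other track
(`eq_translatePair_of_isIsolated`); exchanging the tracks makes it global, since marked
configurations are dense. -/

theorem exists_alternating_map_fix (hC : 4 ≤ Fintype.card C) {x v w : C} (hxv : x ≠ v)
    (hxw : x ≠ w) (hvw : v ≠ w) : ∃ π ∈ alternatingGroup C, π x = v ∧ π w = w := by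
  obtain ⟨u, hu⟩ : ∃ u, u ∉ ({x, v, w} : Finset C) := by
    by_contra! h
    have h1 : Fintype.card C ≤ ({x, v, w} : Finset C).card :=
      Finset.card_le_card fun a _ => h a
    have := Finset.card_le_three (a := x) (b := v) (c := w)
    omega
  simp only [Finset.mem_insert, Finset.mem_singleton, not_or] at hu
  obtain ⟨hux, huv, huw⟩ := hu
  -- The 3-cycle `x → v → u → x`; the fourth point `u` is what makes it even while avoiding `w`.
  refine ⟨Equiv.swap x u * Equiv.swap x v, ?_, ?_, ?_⟩
  · simp [Equiv.Perm.mem_alternatingGroup, hxv, Ne.symm hux]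
  · rw [Equiv.Perm.mul_apply, Equiv.swap_apply_left,
      Equiv.swap_apply_of_ne_of_ne hxv.symm (Ne.symm huv)]
  · rw [Equiv.Perm.mul_apply, Equiv.swap_apply_of_ne_of_ne hxw.symm hvw.symm,
      Equiv.swap_apply_of_ne_of_ne hxw.symm (Ne.symm huw)]

theorem exists_alternating_move_fix (hC : 4 ≤ Fintype.card C) {x w : C} (hxw : x ≠ w) :
    ∃ π ∈ alternatingGroup C, π x ≠ x ∧ π w = w := by
  obtain ⟨v, hv⟩ : ∃ v, v ∉ ({x, w} : Finset C) := by
    by_contra! h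
    have h1 : Fintype.card C ≤ ({x, w} : Finset C).card :=
      Finset.card_le_card fun a _ => h a
    have := Finset.card_le_two (a := x) (b := w)
    omega
  simp only [Finset.mem_insert, Finset.mem_singleton, not_or] at hv
  obtain ⟨π, hπ, h1, h2⟩ := exists_alternating_map_fix hC (Ne.symm hv.1) hxw hv.2
  exact ⟨π, hπ, by rw [h1]; exact hv.1, h2⟩

theorem exists_alternating_map (hC : 4 ≤ Fintype.card C) (x v : C) :
    ∃ π ∈ alternatingGroup C, π x = v := by
  by_cases hxv : x = v
  · exact ⟨1, one_mem _, by simp [hxv]⟩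
  obtain ⟨w, hw⟩ : ∃ w, w ∉ ({x, v} : Finset C) := by
    by_contra! h
    have h1 : Fintype.card C ≤ ({x, v} : Finset C).card :=
      Finset.card_le_card fun a _ => h a
    have := Finset.card_le_two (a := x) (b := v)
    omega
  simp only [Finset.mem_insert, Finset.mem_singleton, not_or] at hw
  obtain ⟨π, hπ, h1, -⟩ := exists_alternating_map_fix hC hxv (Ne.symm hw.1) (Ne.symm hw.2)
  exact ⟨π, hπ, h1⟩

end Permutations

theorem tendsto_of_eqOn {ι D : Type*} [TopologicalSpace D] {u : Finset ι → ι → D} {z : ι → D}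
    (h : ∀ F, ∀ a ∈ F, u F a = z a) : Tendsto u atTop (𝓝 z) := by
  refine tendsto_pi_nhds.2 fun a => tendsto_const_nhds.congr' ?_
  filter_upwards [eventually_ge_atTop {a}] with F hF
  exact (h F a (hF (Finset.mem_singleton_self a))).symm

/-- Apply a permutation of `C × D` in every cell. -/
def cellHom {H C D : Type*} : Equiv.Perm (C × D) →* Equiv.Perm ((H → C) × (H → D)) where
  toFun σ :=
    { toFun := fun y => (fun a => (σ (y.1 a, y.2 a)).1, fun a => (σ (y.1 a, y.2 a)).2)
      invFun := fun y => (fun a => (σ⁻¹ (y.1 a, y.2 a)).1, fun a => (σ⁻¹ (y.1 a, y.2 a)).2)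
      left_inv := fun y => by simp
      right_inv := fun y => by simp }
  map_one' := rfl
  map_mul' σ τ := rfl

theorem continuous_cellHom {H C D : Type*} [TopologicalSpace C] [DiscreteTopology C] [TopologicalSpace D]
    [DiscreteTopology D] (σ : Equiv.Perm (C × D)) :
    Continuous (cellHom σ : Equiv.Perm ((H → C) × (H → D))) := by
  have h (a : H) : Continuous fun y : (H → C) × (H → D) => σ (y.1 a, y.2 a) :=
    continuous_of_discreteTopology.comp (by fun_prop)
  exact (continuous_pi fun a => (h a).fst).prodMk (continuous_pi fun a => (h a).snd)

/-! ### Controlled permutations on two tracks -/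

section TwoTracks

variable {H C D : Type*} [Group H]

/-- The translate of a configuration, `translate g z a = z (a * g)`. -/
def translate (g : H) (z : H → D) : H → D := fun a => z (a * g)

/-- The diagonal translation on pairs of configurations. -/
def translatePair (g : H) (y : (H → C) × (H → D)) : (H → C) × (H → D) :=
  (translate g y.1, translate g y.2)

/-- Cylinder sets: finitely many coordinates are prescribed. -/
inductive IsCylinder : Set (H → D) → Prop
  | univ : IsCylinder Set.univ
  | inter_eval (U : Set (H → D)) (g : H) (q : D) :
      IsCylinder U → IsCylinder (U ∩ {z | z g = q})

theorem IsCylinder.preimage_translate {U : Set (H → D)} (hU : IsCylinder U) (b : H) :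
    IsCylinder {z : H → D | translate b z ∈ U} := by
  induction hU with
  | univ => exact .univ
  | inter_eval U g q _ ih => exact .inter_eval _ (g * b) q ih

open Classical in
/-- Apply `π` to the first track at those positions at which the second track looks like an
element of `U`. -/
noncomputable def gate (U : Set (H → D)) : Equiv.Perm C →* Equiv.Perm ((H → C) × (H → D)) where
  toFun π :=
    { toFun := fun y => (fun a => if translate a y.2 ∈ U then π (y.1 a) else y.1 a, y.2)
      invFun := fun y => (fun a => if translate a y.2 ∈ U then π⁻¹ (y.1 a) else y.1 a, y.2)
      left_inv := fun y => by
        refine Prod.ext (funext fun a => ?_) rfl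
        by_cases h : translate a y.2 ∈ U <;> simp [h]
      right_inv := fun y => by
        refine Prod.ext (funext fun a => ?_) rfl
        by_cases h : translate a y.2 ∈ U <;> simp [h] }
  map_one' := by
    ext y : 1
    refine Prod.ext (funext fun a => ?_) rfl
    simp
  map_mul' π σ := by
    ext y : 1
    refine Prod.ext (funext fun a => ?_) rfl
    by_cases h : translate a y.2 ∈ U <;> simp [h]

theorem gate_snd (U : Set (H → D)) (π : Equiv.Perm C) (y : (H → C) × (H → D)) :
    (gate U π y).2 = y.2 := rfl

theorem gate_fst_of_mem {U : Set (H → D)} (π : Equiv.Perm C) {y : (H → C) × (H → D)} {a : H}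
    (h : translate a y.2 ∈ U) : (gate U π y).1 a = π (y.1 a) := if_pos h

theorem gate_fst_of_notMem {U : Set (H → D)} (π : Equiv.Perm C) {y : (H → C) × (H → D)} {a : H}
    (h : translate a y.2 ∉ U) : (gate U π y).1 a = y.1 a := if_neg h

theorem gate_translatePair (U : Set (H → D)) (π : Equiv.Perm C) (g : H)
    (y : (H → C) × (H → D)) :
    gate U π (translatePair g y) = translatePair g (gate U π y) := by
  refine Prod.ext (funext fun a => ?_) rfl
  have h1 : translate a (translatePair g y).2 = translate (a * g) y.2 := by
    funext b; simp [translate, translatePair, mul_assoc]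
  by_cases h : translate (a * g) y.2 ∈ U
  · rw [gate_fst_of_mem π (h1 ▸ h)]
    exact (gate_fst_of_mem π h).symm
  · rw [gate_fst_of_notMem π (h1 ▸ h)]
    exact (gate_fst_of_notMem π h).symm

/-- Where one of the conditions fails, one factor acts trivially and the commutator collapses. So
commutators produce conjunctions of conditions. -/
theorem commutator_gate (U V : Set (H → D)) (π σ : Equiv.Perm C) :
    ⁅gate (C := C) U π, gate V σ⁆ = gate (U ∩ V) ⁅π, σ⁆ := by
  rw [commutatorElement_def, ← map_inv, ← map_inv]
  ext y : 1
  refine Prod.ext (funext fun a => ?_) rfl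
  simp only [Equiv.Perm.mul_apply]
  by_cases hU : translate a y.2 ∈ U <;> by_cases hV : translate a y.2 ∈ V
  · rw [gate_fst_of_mem _ (by exact hU), gate_fst_of_mem _ (by exact hV),
      gate_fst_of_mem _ (by exact hU), gate_fst_of_mem _ (by exact hV),
      gate_fst_of_mem _ (by exact ⟨hU, hV⟩)]
    simp [commutatorElement_def]
  · rw [gate_fst_of_mem _ (by exact hU), gate_fst_of_notMem _ (by exact hV),
      gate_fst_of_mem _ (by exact hU), gate_fst_of_notMem _ (by exact hV),
      gate_fst_of_notMem _ (by exact fun h => hV h.2)]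
    simp
  · rw [gate_fst_of_notMem _ (by exact hU), gate_fst_of_mem _ (by exact hV),
      gate_fst_of_notMem _ (by exact hU), gate_fst_of_mem _ (by exact hV),
      gate_fst_of_notMem _ (by exact fun h => hU h.1)]
    simp
  · rw [gate_fst_of_notMem _ (by exact hU), gate_fst_of_notMem _ (by exact hV),
      gate_fst_of_notMem _ (by exact hU), gate_fst_of_notMem _ (by exact hV),
      gate_fst_of_notMem _ (by exact fun h => hU h.1)]

/-- Translate the two tracks independently, on the side that commutes with `translatePair`. -/
def slideHom : H × H →* Equiv.Perm ((H → C) × (H → D)) where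
  toFun g :=
    { toFun := fun y => (fun a => y.1 (g.1⁻¹ * a), fun a => y.2 (g.2⁻¹ * a))
      invFun := fun y => (fun a => y.1 (g.1 * a), fun a => y.2 (g.2 * a))
      left_inv := fun y => by simp
      right_inv := fun y => by simp }
  map_one' := by ext y : 1; simp
  map_mul' g h := by ext y : 1; simp [mul_assoc]

/-- The bijections commuting with a given self-map. -/
def commuting {Y : Type*} (φ : Y → Y) : Subgroup (Equiv.Perm Y) where
  carrier := {p | ∀ y, φ (p y) = p (φ y)}
  one_mem' := fun _ => rfl
  mul_mem' := fun {p q} hp hq y => by rw [Equiv.Perm.mul_apply, hp, hq]; rfl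
  inv_mem' := fun {p} hp y => by
    rw [Equiv.Perm.eq_inv_iff_eq, ← hp]; simp

theorem mem_commuting {Y : Type*} {φ : Y → Y} {p : Equiv.Perm Y} :
    p ∈ commuting φ ↔ ∀ y, φ (p y) = p (φ y) := Iff.rfl

/-- All even permutations, controlled by cylinders, belong to a group that contains the cellwise
permutations and the slides of the second track. -/
theorem gate_mem [Fintype C] [DecidableEq C] (hC : 5 ≤ Fintype.card C)
    {P : Subgroup (Equiv.Perm ((H → C) × (H → D)))}
    (hcell : ∀ σ, cellHom σ ∈ P) (hslide : ∀ h, slideHom (1, h) ∈ P)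
    {U : Set (H → D)} (hU : IsCylinder U) :
    alternatingGroup C ≤ P.comap (gate U) := by
  classical
  induction hU with
  | univ =>
    intro π _
    have h1 : gate (Set.univ : Set (H → D)) π = cellHom (Equiv.prodCongr π (Equiv.refl D)) := by
      ext y : 1
      refine Prod.ext (funext fun a => ?_) rfl
      exact gate_fst_of_mem _ (Set.mem_univ _)
    rw [Subgroup.mem_comap, h1]
    exact hcell _
  | inter_eval U g q _ ih =>
    have key (π : Equiv.Perm C) : gate {z : H → D | z g = q} π ∈ P := by
      let τ : Equiv.Perm (C × D) :=
        { toFun := fun x => (if x.2 = q then π x.1 else x.1, x.2)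
          invFun := fun x => (if x.2 = q then π⁻¹ x.1 else x.1, x.2)
          left_inv := fun x => by by_cases h : x.2 = q <;> simp [h, Prod.ext_iff]
          right_inv := fun x => by by_cases h : x.2 = q <;> simp [h, Prod.ext_iff] }
      -- Sliding the second track brings the symbol at `g * a` into cell `a`, where a cellwise
      -- permutation can read it.
      have h1 : gate {z : H → D | z g = q} π =
          (slideHom (1, g⁻¹))⁻¹ * cellHom τ * slideHom (1, g⁻¹) := by
        rw [← map_inv]
        ext y : 1
        refine Prod.ext (funext fun a => ?_) (funext fun a => ?_)
        · by_cases h : y.2 (g * a) = q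
          · rw [gate_fst_of_mem _ (by exact h)]
            simp [slideHom, cellHom, τ, h]
          · rw [gate_fst_of_notMem _ (by exact h)]
            simp [slideHom, cellHom, τ, h]
        · simp [slideHom, cellHom, τ, gate_snd]
      rw [h1]
      exact P.mul_mem (P.mul_mem (P.inv_mem (hslide _)) (hcell _)) (hslide _)
    -- Perfectness, hence `5 ≤ |C|`, ensures that no even permutation is lost when a condition is
    -- added.
    rw [← commutator_alternatingGroup_eq_self (by simpa using hC), Subgroup.commutator_le]
    intro π hπ σ _
    rw [Subgroup.mem_comap, ← commutator_gate]
    exact P.mul_mem (P.mul_mem (P.mul_mem (ih hπ) (key σ)) (P.inv_mem (ih hπ))) (P.inv_mem (key σ))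

/-- Some cylinder meets the orbit of `d` once only. -/
def IsIsolated (d : H → D) : Prop :=
  ∃ U : Set (H → D), IsCylinder U ∧ ∃ a₀, ∀ a, translate a d ∈ U ↔ a = a₀

/-- This is density of the isolated configurations: outside `F`, write `u` at `s`, `v` at `g * s`
and `w` elsewhere. The marker is "`u` here, `v` at offset `g`". -/
theorem exists_isIsolated_eqOn [Infinite H] [Fintype D] (hD : 3 ≤ Fintype.card D) (F : Finset H)
    (p : H → D) : ∃ d : H → D, IsIsolated d ∧ ∀ a ∈ F, d a = p a := by
  classical
  obtain ⟨u, v, w, huv, huw, hvw⟩ := Fintype.two_lt_card_iff.1 hD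
  obtain ⟨s, hs⟩ := Infinite.exists_notMem_finset F
  -- Avoiding `F * F⁻¹` prevents a marker inside `F`; avoiding `F * s⁻¹` and `1` keeps `g * s` out
  -- of `F` and distinct from `s`.
  obtain ⟨g, hg⟩ := Infinite.exists_notMem_finset
    (insert 1 (((F ×ˢ F).image fun x => x.1 * x.2⁻¹) ∪ F.image fun x => x * s⁻¹))
  simp only [Finset.mem_insert, Finset.mem_union, Finset.mem_image, Finset.mem_product,
    not_or, not_exists, not_and, Prod.forall] at hg
  obtain ⟨hg1, hgF, hgs⟩ := hg
  have hgsF : g * s ∉ F := fun h => hgs _ h (by simp)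
  have hne : g * s ≠ s := fun h => hg1 (mul_eq_right.1 h)
  let d : H → D := fun a => if a ∈ F then p a else if a = s then u else if a = g * s then v else w
  have hds : d s = u := by simp [d, hs]
  have hdgs : d (g * s) = v := by simp [d, hgsF, hne]
  refine ⟨d, ⟨_, .inter_eval _ g v (.inter_eval _ 1 u .univ), s, fun a => ⟨fun h => ?_, ?_⟩⟩,
    fun a ha => by simp [d, ha]⟩
  · obtain ⟨⟨-, h1⟩, h2⟩ := h
    simp only [translate, Set.mem_ofPred_eq, one_mul] at h1 h2
    have hmem (b : H) : b ∈ F ∨ b = s ∨ b = g * s ∨ d b = w := by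
      by_cases h1 : b ∈ F
      · exact .inl h1
      by_cases h2 : b = s
      · exact .inr (.inl h2)
      by_cases h3 : b = g * s
      · exact .inr (.inr (.inl h3))
      exact .inr (.inr (.inr (by simp [d, h1, h2, h3])))
    rcases hmem a with ha | ha | ha | ha
    · rcases hmem (g * a) with hb | hb | hb | hb
      · exact absurd (by simp) (hgF _ _ ⟨hb, ha⟩)
      · rw [hb, hds] at h2; exact absurd h2 huv
      · exact mul_left_cancel hb
      · exact absurd (h2.symm.trans hb) hvw
    · exact ha
    · rw [ha, hdgs] at h1; exact absurd h1.symm huv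
    · exact absurd (h1.symm.trans ha) huw
  · rintro rfl
    exact ⟨⟨trivial, by simpa [translate] using hds⟩, hdgs⟩

theorem translate_translate (a b : H) (z : H → D) :
    translate a (translate b z) = translate (a * b) z := by
  funext x; simp [translate, mul_assoc]

theorem continuous_translatePair [TopologicalSpace C] [TopologicalSpace D] (g : H) :
    Continuous (translatePair (C := C) (D := D) g) := by
  unfold translatePair translate
  fun_prop

/-! ### Maps commuting with the gates -/

section Centralizer

variable [Fintype C] [DecidableEq C]

theorem forall_gate_fix_iff (hC : 4 ≤ Fintype.card C) (U : Set (H → D)) (v : C)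
    (y : (H → C) × (H → D)) :
    (∀ π ∈ alternatingGroup C, π v = v → gate U π y = y) ↔
      ∀ a, translate a y.2 ∈ U → y.1 a = v := by
  refine ⟨fun h a ha => ?_, fun h π _ hv => ?_⟩
  · by_contra hne
    obtain ⟨π, hπ, h1, h2⟩ := exists_alternating_move_fix hC hne
    exact h1 (by rw [← gate_fst_of_mem π ha, h π hπ h2])
  · refine Prod.ext (funext fun a => ?_) rfl
    by_cases ha : translate a y.2 ∈ U
    · rw [gate_fst_of_mem π ha, h a ha, hv]
    · rw [gate_fst_of_notMem π ha]

/-- A map commuting with the gates preserves, for every cylinder, the property that the second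
track meets it only where the first track has a given symbol. -/
theorem forall_translate_mem_iff (hC : 4 ≤ Fintype.card C)
    {φ : (H → C) × (H → D) → (H → C) × (H → D)} (hinj : Injective φ) {U : Set (H → D)}
    (hφ : alternatingGroup C ≤ (commuting φ).comap (gate U)) (v : C) (y : (H → C) × (H → D)) :
    (∀ a, translate a (φ y).2 ∈ U → (φ y).1 a = v) ↔
      ∀ a, translate a y.2 ∈ U → y.1 a = v := by
  rw [← forall_gate_fix_iff hC, ← forall_gate_fix_iff hC]
  refine forall_congr' fun π => forall_congr' fun hπ => ?_
  rw [← mem_commuting.1 (hφ hπ) y, hinj.eq_iff]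

theorem exists_eq_translatePair (hC : 4 ≤ Fintype.card C)
    {φ : (H → C) × (H → D) → (H → C) × (H → D)} (hinj : Injective φ)
    (hφ : ∀ U : Set (H → D), IsCylinder U → alternatingGroup C ≤ (commuting φ).comap (gate U))
    (y : (H → C) × (H → D)) (hy : IsIsolated y.2) : ∃ g, φ y = translatePair g y := by
  obtain ⟨U, hU, a₀, h₀⟩ := hy
  have key {V : Set (H → D)} (hV : IsCylinder V) := forall_translate_mem_iff hC hinj (hφ V hV)
  have : Nontrivial C := Fintype.one_lt_card_iff_nontrivial.1 (by omega)
  -- If the image had no marker, the preserved property would hold vacuously for every symbol `v`,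
  -- but for `y` it forces `v = y.1 a₀`.
  have hex : ∃ a, translate a (φ y).2 ∈ U := by
    by_contra! h
    obtain ⟨v, hv⟩ := exists_ne (y.1 a₀)
    exact hv ((key hU v y).1 (fun a ha => absurd ha (h a)) a₀ ((h₀ a₀).2 rfl)).symm
  obtain ⟨a₁, h₁⟩ := hex
  -- Refine `U` by the symbol that the image shows at offset `b`. Were it wrong, `y` would never
  -- meet the refined cylinder, and the same vacuity argument applies.
  have h2 (b : H) : (φ y).2 (b * a₁) = y.2 (b * a₀) := by
    by_contra hne
    obtain ⟨v, hv⟩ := exists_ne ((φ y).1 a₁)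
    refine hv ((key (.inter_eval U b ((φ y).2 (b * a₁)) hU) v y).2 ?_ a₁ ⟨h₁, rfl⟩).symm
    rintro a ⟨ha, hq⟩
    rw [(h₀ a).1 ha] at hq
    exact absurd hq.symm hne
  -- The shifted marker occurs in `y` only at `b * a₀`, so the property compares first tracks at
  -- that one cell.
  have h1 (b : H) : (φ y).1 (b * a₁) = y.1 (b * a₀) := by
    refine (key (hU.preimage_translate b⁻¹) (y.1 (b * a₀)) y).2 (fun a ha => ?_) _ ?_
    · rw [Set.mem_ofPred_eq, translate_translate, h₀, inv_mul_eq_iff_eq_mul] at ha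
      rw [ha]
    · rwa [Set.mem_ofPred_eq, translate_translate, inv_mul_cancel_left]
  refine ⟨a₁⁻¹ * a₀, Prod.ext (funext fun a => ?_) (funext fun a => ?_)⟩
  · simpa [translatePair, translate, mul_assoc] using h1 (a * a₁⁻¹)
  · simpa [translatePair, translate, mul_assoc] using h2 (a * a₁⁻¹)

/-- A gate triggered by the isolated marker changes a single cell of the first track. Both `φ` and
the translation commute with it, so agreement passes to finite modifications, then to limits by
continuity. -/
theorem eq_translatePair_of_isIsolated [TopologicalSpace C] [DiscreteTopology C]
    [TopologicalSpace D] [DiscreteTopology D] (hC : 4 ≤ Fintype.card C)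
    {φ : (H → C) × (H → D) → (H → C) × (H → D)} (hcont : Continuous φ)
    (hφ : ∀ U : Set (H → D), IsCylinder U → alternatingGroup C ≤ (commuting φ).comap (gate U))
    {d : H → D} (hd : IsIsolated d) {g : H} {c : H → C}
    (hc : φ (c, d) = translatePair g (c, d)) (c' : H → C) :
    φ (c', d) = translatePair g (c', d) := by
  classical
  have hupd (e : H → C) (he : φ (e, d) = translatePair g (e, d)) (b : H) (v : C) :
      φ (update e b v, d) = translatePair g (update e b v, d) := by
    obtain ⟨U, hU, a₀, h₀⟩ := hd
    obtain ⟨π, hπ, hv⟩ := exists_alternating_map hC (e b) v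
    -- Recentres the marker so that its only occurrence is at `b` instead of `a₀`.
    have hV := hU.preimage_translate (a₀ * b⁻¹)
    have hmem (a : H) : translate a d ∈ {z : H → D | translate (a₀ * b⁻¹) z ∈ U} ↔ a = b := by
      rw [Set.mem_ofPred_eq, translate_translate, h₀, mul_assoc, mul_eq_left, inv_mul_eq_one,
        eq_comm]
    have heq : (update e b v, d) = gate {z : H → D | translate (a₀ * b⁻¹) z ∈ U} π (e, d) := by
      refine Prod.ext (funext fun a => ?_) rfl
      by_cases hab : a = b
      · rw [gate_fst_of_mem _ ((hmem a).2 hab), hab, hv]; simp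
      · rw [gate_fst_of_notMem _ (mt (hmem a).1 hab)]; simp [hab]
    rw [heq, mem_commuting.1 (hφ _ hV hπ), he, gate_translatePair]
  have hfin (F : Finset H) :
      φ (F.piecewise c' c, d) = translatePair g (F.piecewise c' c, d) := by
    induction F using Finset.induction_on with
    | empty => simpa using hc
    | insert b F _ ih => rw [Finset.piecewise_insert]; exact hupd _ ih _ _
  have hlim : Tendsto (fun F : Finset H => (F.piecewise c' c, d)) atTop (𝓝 (c', d)) :=
    Tendsto.prodMk_nhds (tendsto_of_eqOn (u := fun F => F.piecewise c' c) fun F _ ha =>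
      F.piecewise_eq_of_mem c' c ha) tendsto_const_nhds
  exact tendsto_nhds_unique ((hcont.tendsto _).comp hlim)
    ((((continuous_translatePair g).tendsto _).comp hlim).congr fun F => (hfin F).symm)

end Centralizer

/-- An injective continuous map commuting with the cellwise permutations and with the slides of
each track is a translation. -/
theorem exists_forall_eq_translatePair [Infinite H] [Fintype C] [TopologicalSpace C]
    [DiscreteTopology C] [Fintype D] [TopologicalSpace D] [DiscreteTopology D]
    (hC : 5 ≤ Fintype.card C) (hD : 5 ≤ Fintype.card D)
    {φ : (H → C) × (H → D) → (H → C) × (H → D)} (hcont : Continuous φ) (hinj : Injective φ)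
    (hcell : ∀ σ, cellHom σ ∈ commuting φ) (hslide : ∀ g, slideHom g ∈ commuting φ) :
    ∃ g, ∀ y, φ y = translatePair g y := by
  classical
  have hφ (U : Set (H → D)) (hU : IsCylinder U) :=
    gate_mem hC hcell (fun h => hslide (1, h)) hU
  let ψ : (H → D) × (H → C) → (H → D) × (H → C) := fun z => (φ z.swap).swap
  have hψcont : Continuous ψ := by fun_prop
  have hψinj : Injective ψ :=
    Prod.swap_injective.comp (hinj.comp Prod.swap_injective)
  have hψ (U : Set (H → C)) (hU : IsCylinder U) :
      alternatingGroup D ≤ (commuting ψ).comap (gate U) := by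
    refine gate_mem hD (fun σ z => ?_) (fun h z => ?_) hU
    · exact congrArg Prod.swap
        (hcell ((Equiv.prodComm C D).trans (σ.trans (Equiv.prodComm D C))) z.swap)
    · exact congrArg Prod.swap (hslide (h, 1) z.swap)
  have hψφ {y : (H → C) × (H → D)} {g : H} :
      φ y = translatePair g y ↔ ψ y.swap = translatePair g y.swap :=
    Prod.swap_injective.eq_iff.symm
  obtain ⟨c₀, hc₀, -⟩ := exists_isIsolated_eqOn (H := H) (D := C) (by omega) ∅
    (fun _ => (Fintype.card_pos_iff.1 (by omega)).some)
  obtain ⟨d₀, hd₀, -⟩ := exists_isIsolated_eqOn (H := H) (D := D) (by omega) ∅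
    (fun _ => (Fintype.card_pos_iff.1 (by omega)).some)
  obtain ⟨g, hg⟩ := exists_eq_translatePair (by omega) hinj hφ (c₀, d₀) hd₀
  -- With `c₀` as the control track, one `g` serves every `d`; this later fixes the translation for
  -- each isolated `u F`.
  have hc₀all (d : H → D) : φ (c₀, d) = translatePair g (c₀, d) :=
    hψφ.2 (eq_translatePair_of_isIsolated (by omega) hψcont hψ hc₀ (hψφ.1 hg) d)
  refine ⟨g, fun y => ?_⟩
  choose u hu hy using fun F => exists_isIsolated_eqOn (by omega : 3 ≤ Fintype.card D) F y.2
  have hlim : Tendsto (fun F => (y.1, u F)) atTop (𝓝 y) :=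
    tendsto_const_nhds.prodMk_nhds (tendsto_of_eqOn hy)
  exact tendsto_nhds_unique ((hcont.tendsto _).comp hlim)
    ((((continuous_translatePair g).tendsto _).comp hlim).congr fun F =>
      (eq_translatePair_of_isIsolated (by omega) hcont hφ (hu F) (hc₀all _) _).symm)

/-- Transport a continuous action on `Y` to a homomorphism into the homeomorphisms of `X`. -/
def homeomorphHom {M X Y : Type*} [Group M] [TopologicalSpace X] [TopologicalSpace Y]
    (e : X ≃ₜ Y) (f : M →* Equiv.Perm Y) (hf : ∀ m, Continuous (f m)) : M →* (X ≃ₜ X) where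
  toFun m :=
    { toFun := fun x => e.symm (f m (e x))
      invFun := fun x => e.symm (f m⁻¹ (e x))
      left_inv := fun x => by simp
      right_inv := fun x => by simp
      continuous_toFun := e.symm.continuous.comp ((hf m).comp e.continuous)
      continuous_invFun := e.symm.continuous.comp ((hf m⁻¹).comp e.continuous) }
  map_one' := by ext x; simp
  map_mul' m n := by ext x; simp

theorem apply_homeomorphHom {M X Y : Type*} [Group M] [TopologicalSpace X] [TopologicalSpace Y]
    (e : X ≃ₜ Y) (f : M →* Equiv.Perm Y) (hf : ∀ m, Continuous (f m)) (m : M) (x : X) :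
    e (homeomorphHom e f hf m x) = f m (e x) := e.apply_symm_apply _

theorem continuous_slideHom [TopologicalSpace C] [TopologicalSpace D] (g : H × H) :
    Continuous (slideHom g : Equiv.Perm ((H → C) × (H → D))) := by
  change Continuous fun y : (H → C) × (H → D) =>
    ((fun a => y.1 (g.1⁻¹ * a), fun a => y.2 (g.2⁻¹ * a)) : (H → C) × (H → D))
  fun_prop

/-- A system conjugate to a full shift with two large tracks over an infinite finitely generated
group satisfies the strong finitary Ryan theorem. -/
theorem strongFinitaryRyan_of_homeomorph {X : Type*} [TopologicalSpace X] [Infinite H]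
    [Group.FG H] [Fintype C] [TopologicalSpace C] [DiscreteTopology C] [Fintype D]
    [TopologicalSpace D] [DiscreteTopology D] (hC : 5 ≤ Fintype.card C)
    (hD : 5 ≤ Fintype.card D) (ρ : H →* (X ≃ₜ X)) (e : X ≃ₜ (H → C) × (H → D))
    (he : ∀ g x, e (ρ g x) = translatePair g (e x)) : StrongFinitaryRyan ρ := by
  let cell := homeomorphHom e (cellHom (H := H) (C := C) (D := D)) continuous_cellHom
  let slide := homeomorphHom e (slideHom (H := H) (C := C) (D := D)) continuous_slideHom
  have hK : cell.range ⊔ slide.range ≤ autGroup ρ := by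
    refine sup_le ?_ ?_
    · rintro _ ⟨σ, rfl⟩ g
      refine Homeomorph.ext fun x => e.injective ?_
      rw [Homeomorph.mul_apply, Homeomorph.mul_apply, apply_homeomorphHom, he, he,
        apply_homeomorphHom]
      rfl
    · rintro _ ⟨h, rfl⟩ g
      refine Homeomorph.ext fun x => e.injective ?_
      rw [Homeomorph.mul_apply, Homeomorph.mul_apply, apply_homeomorphHom, he, he,
        apply_homeomorphHom]
      simp [slideHom, translatePair, translate, mul_assoc, funext_iff]
  refine ⟨cell.range ⊔ slide.range, hK, ?_, le_antisymm (fun φ hφ => ?_) ?_⟩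
  -- The cellwise part is the image of a finite group, the slides that of `H × H`.
  · exact ((Group.fg_iff_subgroup_fg _).1 inferInstance).sup
      ((Group.fg_iff_subgroup_fg _).1 inferInstance)
  · rw [Subgroup.mem_centralizer_iff] at hφ
    have hcomm {k : X ≃ₜ X} (hk : k ∈ cell.range ⊔ slide.range)
        {p : Equiv.Perm ((H → C) × (H → D))} (hp : ∀ x, e (k x) = p (e x)) :
        p ∈ commuting fun y => e (φ (e.symm y)) := by
      intro y
      have h1 := congrArg e (DFunLike.congr_fun (hφ _ hk) (e.symm y))
      rw [Homeomorph.mul_apply, Homeomorph.mul_apply, hp] at h1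
      rw [h1]
      refine congrArg (fun z => e (φ z)) (e.injective ?_)
      rw [hp, e.apply_symm_apply, e.apply_symm_apply]
    obtain ⟨g, hg⟩ := exists_forall_eq_translatePair hC hD
      (φ := fun y => e (φ (e.symm y))) (by fun_prop)
      (e.injective.comp (φ.injective.comp e.symm.injective))
      (fun σ => hcomm (Subgroup.mem_sup_left ⟨σ, rfl⟩) (apply_homeomorphHom _ _ _ σ))
      (fun h => hcomm (Subgroup.mem_sup_right ⟨h, rfl⟩) (apply_homeomorphHom _ _ _ h))
    refine ⟨g, Homeomorph.ext fun x => e.injective ?_⟩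
    rw [he, ← hg, e.symm_apply_apply]
  · rintro _ ⟨g, rfl⟩
    rw [Subgroup.mem_centralizer_iff]
    exact fun k hk => hK hk g

end TwoTracks

/-! ### From the full shift to two tracks -/

section FullShift

variable {G A : Type*} [Group G]

/-- Intersecting finitely many finite-index subgroups puts `n` chosen elements in distinct cosets.
-/
theorem exists_finiteIndex_le_index [Infinite G] [Group.ResiduallyFinite G] (n : ℕ) :
    ∃ H : Subgroup G, H.FiniteIndex ∧ n ≤ H.index := by
  classical
  obtain ⟨s, hs⟩ := Infinite.exists_subset_card_eq G n
  have hsep (x : G × G) : ∃ H : Subgroup G, H.FiniteIndex ∧ (x.1 ≠ x.2 → x.1⁻¹ * x.2 ∉ H) := by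
    by_cases hx : x.1 = x.2
    · exact ⟨⊤, inferInstance, fun h => absurd hx h⟩
    · obtain ⟨H, hH, hn⟩ := Group.residuallyFinite_iff_exists_finiteIndex.1
        inferInstance (x.1⁻¹ * x.2) (by rwa [Ne, inv_mul_eq_one])
      exact ⟨H, hH, fun _ => hn⟩
  choose N hN hsepN using hsep
  have hfin : (⨅ x ∈ s ×ˢ s, N x).FiniteIndex := Subgroup.finiteIndex_iInf' _ fun x _ => hN x
  refine ⟨⨅ x ∈ s ×ˢ s, N x, hfin, ?_⟩
  have hinj : Injective fun x : s => ((x : G) : G ⧸ ⨅ x ∈ s ×ˢ s, N x) := by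
    intro x y hxy
    by_contra hne
    have h1 := QuotientGroup.eq.1 hxy
    simp only [Subgroup.mem_iInf] at h1
    exact hsepN (x, y) (fun h => hne (Subtype.ext h)) (h1 (x, y) (by simp))
  have h2 := Nat.card_le_card_of_injective _ hinj
  rwa [Nat.card_eq_fintype_card, Fintype.card_coe, hs] at h2

/-- A configuration on `G` as a pair of configurations on `H`: the cells of the cosets that
satisfy `p`, and the cells of the other cosets. -/
noncomputable def cosetHomeomorph [TopologicalSpace A] [DiscreteTopology A] [Finite A]
    (H : Subgroup G) (p : G ⧸ H → Prop) :
    (G → A) ≃ₜ (H → {q // p q} → A) × (H → {q // ¬ p q} → A) :=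
  Continuous.homeoOfEquivCompactToT2
    (f := Equiv.ofBijective
      (fun x => (fun h q => x (q.1.out * h), fun h q => x (q.1.out * h))) <| by
        classical
        -- Each `g` is a coset representative times an element of `H`; left cosets suit the shift,
        -- which multiplies on the right.
        have hmem (g : G) : (g : G ⧸ H).out⁻¹ * g ∈ H := QuotientGroup.eq.1 (by simp)
        refine ⟨fun x y hxy => funext fun g => ?_, fun y => ?_⟩
        · obtain ⟨h1, h2⟩ := Prod.ext_iff.1 hxy
          by_cases hp : p g
          · simpa using congrFun (congrFun h1 ⟨_, hmem g⟩) ⟨g, hp⟩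
          · simpa using congrFun (congrFun h2 ⟨_, hmem g⟩) ⟨g, hp⟩
        · have hmk (q : G ⧸ H) (h : H) : ((q.out * h : G) : G ⧸ H) = q := by
            rw [QuotientGroup.mk_mul_of_mem _ h.2, QuotientGroup.out_eq']
          have hsub (q : G ⧸ H) (h : H) :
              (⟨_, hmem (q.out * h)⟩ : H) = h := Subtype.ext <| by
            change ((q.out * h : G) : G ⧸ H).out⁻¹ * (q.out * h) = h
            rw [hmk, inv_mul_cancel_left]
          refine ⟨fun g => if hp : p g then y.1 ⟨_, hmem g⟩ ⟨g, hp⟩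
            else y.2 ⟨_, hmem g⟩ ⟨g, hp⟩, Prod.ext ?_ ?_⟩
          · funext h ⟨q, hq⟩
            have hq' : p ((q.out * h : G) : G ⧸ H) := by rwa [hmk]
            change dite _ _ _ = _
            rw [dif_pos hq', hsub]
            exact congrArg (y.1 h) (Subtype.ext (hmk q h))
          · funext h ⟨q, hq⟩
            have hq' : ¬ p ((q.out * h : G) : G ⧸ H) := by rwa [hmk]
            change dite _ _ _ = _
            rw [dif_neg hq', hsub]
            exact congrArg (y.2 h) (Subtype.ext (hmk q h)))
    (by
      change Continuous fun x : G → A =>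
        ((fun h q => x (q.1.out * h), fun h q => x (q.1.out * h)) :
          (H → {q // p q} → A) × (H → {q // ¬ p q} → A))
      fun_prop)

theorem cosetHomeomorph_shift [TopologicalSpace A] [DiscreteTopology A] [Finite A]
    (H : Subgroup G) (p : G ⧸ H → Prop) (h : H) (x : G → A) :
    cosetHomeomorph H p (restrict (fullShift A G) H h x) =
      translatePair h (cosetHomeomorph H p x) := by
  refine Prod.ext (funext fun a => funext fun q => ?_) (funext fun a => funext fun q => ?_)
  all_goals exact congrArg x (mul_assoc _ _ _)

theorem strongFinitaryRyan_restrict_fullShift [TopologicalSpace A] [DiscreteTopology A]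
    [Finite A] [Nontrivial A] [Infinite G] [Group.FG G] (H : Subgroup G) [H.FiniteIndex]
    (hH : 6 ≤ H.index) : StrongFinitaryRyan (restrict (fullShift A G) H) := by
  classical
  have : Infinite H := by
    by_contra hfin
    rw [not_infinite_iff_finite] at hfin
    exact not_finite_iff_infinite.2 ‹_›
      (Subgroup.finite_iff_finite_and_finiteIndex (H := H) |>.2 ⟨hfin, inferInstance⟩)
  let _ := Fintype.ofFinite (G ⧸ H)
  have hcard : 6 ≤ Fintype.card (G ⧸ H) := by rwa [← Nat.card_eq_fintype_card]
  obtain ⟨s, -, hs⟩ := Finset.exists_subset_card_eq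
    (show 3 ≤ (Finset.univ : Finset (G ⧸ H)).card by rw [Finset.card_univ]; omega)
  -- Three cosets per block are needed when `|A| = 2`, since `2 ^ 2 < 5 ≤ 2 ^ 3`; hence index at
  -- least six.
  have hpow {ι : Type _} [Finite ι] (h : 3 ≤ Nat.card ι) : 5 ≤ Nat.card (ι → A) := by
    rw [Nat.card_fun]
    calc 5 ≤ 2 ^ 3 := by norm_num
      _ ≤ Nat.card A ^ 3 := Nat.pow_le_pow_left Finite.one_lt_card 3
      _ ≤ Nat.card A ^ Nat.card ι := Nat.pow_le_pow_right Nat.card_pos h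
  have h1 : Nat.card {q // q ∈ s} = 3 := by simp [hs]
  have h2 : Nat.card {q // q ∉ s} = Fintype.card (G ⧸ H) - 3 := by
    rw [Nat.card_eq_fintype_card, Fintype.card_subtype_compl, Fintype.card_coe, hs]
  let _ := Fintype.ofFinite ({q // q ∈ s} → A)
  let _ := Fintype.ofFinite ({q // q ∉ s} → A)
  refine strongFinitaryRyan_of_homeomorph (C := {q // q ∈ s} → A) (D := {q // q ∉ s} → A)
    ?_ ?_ _ (cosetHomeomorph H fun q => q ∈ s) (cosetHomeomorph_shift H _)
  · rw [← Nat.card_eq_fintype_card]; exact hpow (by omega)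
  · rw [← Nat.card_eq_fintype_card]; exact hpow (by omega)

end FullShift

end FinitaryRyan

theorem mainTheorem10 {G A : Type*} [Group G] [Infinite G] [Group.FG G] [Group.ResiduallyFinite G]
    [TopologicalSpace A] [DiscreteTopology A] [Finite A] [Nontrivial A] :
    ∃ H : Subgroup G, H.FiniteIndex ∧ H.FG ∧
      FinitaryRyan.StrongFinitaryRyan
        (FinitaryRyan.restrict (FinitaryRyan.fullShift A G) H) := by
  obtain ⟨H, hH, hi⟩ := FinitaryRyan.exists_finiteIndex_le_index (G := G) 6
  exact ⟨H, hH, (Group.fg_iff_subgroup_fg H).1 inferInstance,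
    FinitaryRyan.strongFinitaryRyan_restrict_fullShift H hi⟩
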